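/- Let $K$ be a field. A weighted graph $(E,w)$ consists of a directed graph $E=(E^0,E^1,s,r)$ and a map $w:E^1\to\{1,2,\dots\}$; the elements of $E^1$ are called structured edges, and $(E,w)$ is finite if $E^0$ and $E^1$ are finite. Put $w(v)=\max\{w(e)\mid e\in s^{-1}(v)\}$ for every vertex $v$ with $s^{-1}(v)\neq\emptyset$. For finite $(E,w)$, the weighted Leavitt path algebra $L_K(E,w)$ is the (not necessarily unital) associative $K$-algebra generated by the vertices $v\in E^0$ and the symbols $e_i,e_i^*$ ($e\in E^1$, $1\le i\le w(e)$) subject to the relations (a) $uv=\delta_{uv}u$ for $u,v\in E^0$; (b) $s(e)e_i=e_i=e_ir(e)$ and $r(e)e_i^*=e_i^*=e_i^*s(e)$ for $e\in E^1$, $1\le i\le w(e)$; (c) $\sum_{e\in s^{-1}(v)}e_ie_j^*=\delta_{ij}v$ for every $v$ with $s^{-1}(v)\ne\emptyset$ and $1\le i,j\le w(v)$; (d) $\sum_{i=1}^{w(v)}e_i^*f_i=\delta_{ef}r(e)$ for every $v$ with $s^{-1}(v)\ne\emptyset$ and $e,f\in s^{-1}(v)$; where $e_i=e_i^*=0$ for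 $i>w(e)$. For $m,n\ge 1$, the Leavitt algebra $L_K(m,n)$ is the unital associative $K$-algebra generated by the entries of an $m\times n$ matrix $X$ and an $n\times m$ matrix $Y$ subject to $XY=I_m$ and $YX=I_n$. Let $A$ be a $K$-algebra that is generated, as a not necessarily unital algebra, by a finite-dimensional subspace $V$, and let $d_V(n)$ be the dimension of the span of all products $v_1\cdots v_k$ with $1\le k\le n$ and $v_1,\dots,v_k\in V$. Then $A$ has exponential growth if there is a real number $a>1$ with $d_V\sim a^n$, where $f\sim g$ means that there are integers $c,c'\ge1$ such that $f(n)\le c\,g(cn)$ and $g(n)\le c'f(c'n)$ for all $n\ge1$; and $\operatorname{GKdim}A=\limsup_{n\to\infty}\log_n d_V(n)$. Neither notion depends on the choice of $V$. (1) Let $(E,w)$ be a finite weighted graph. If there are a vertex $v$ and two distinct structured edges $e,f\in s^{-1}(v)$ with $w(e)\ge2$ and $w(f)\ge2$, then $L_K(E,w)$ has exponential growth, and hence $\operatorname{GKdim}L_K(E,w)=\infty$. (2) In particular, for all integers $n>1$ and $k\ge0$, the Leavitt algebra $L_K(n,n+k)$ has exponential growth, and hence $\operatorname{GKdim}L_K(n,n+k)=\infty$.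 -/

import Mathlib

open Filter

noncomputable section

/-! ### Growth of (not necessarily unital) algebras -/

namespace AlgGrowth

/-- `IsProd V k x` says that `x = v₁ ⋯ v_k` for some `v₁, …, v_k ∈ V` (so `k ≥ 1`). -/
inductive IsProd {A : Type*} [Mul A] (V : Set A) : ℕ → A → Prop
  | single {v : A} : v ∈ V → IsProd V 1 v
  | mul {k : ℕ} {x v : A} : IsProd V k x → v ∈ V → IsProd V (k + 1) (x * v)

variable (K : Type*) [Field K]

section
variable {A : Type*} [NonUnitalRing A] [Module K A]

/-- `V ^ n`: the span of all products `v₁ ⋯ v_k` with `1 ≤ k ≤ n` and all `v_i ∈ V`. -/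
def pow (V : Submodule K A) (n : ℕ) : Submodule K A :=
  Submodule.span K {x | ∃ k ≤ n, IsProd (V : Set A) k x}

/-- `d_V(n) = dim V ^ n`. -/
def growth (V : Submodule K A) (n : ℕ) : ℕ := Module.finrank K (pow K V n)

end

/-- `V` is a finite-dimensional subspace that generates the (possibly non-unital) algebra `A`. -/
def IsGenerating {A : Type*} [NonUnitalRing A] [Module K A] [IsScalarTower K A A]
    [SMulCommClass K A A] (V : Submodule K A) : Prop :=
  FiniteDimensional K V ∧ NonUnitalAlgebra.adjoin K (V : Set A) = ⊤

/-- `f ≼ g` for functions on the positive integers: there is a positive integer `c` with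
`f n ≤ c * g (c * n)` for all `n ≥ 1`. -/
def Preccurly (f g : ℕ → ℝ) : Prop :=
  ∃ c : ℕ, 0 < c ∧ ∀ n : ℕ, 0 < n → f n ≤ c * g (c * n)

/-- Asymptotic equivalence `f ∼ g`. -/
def AsympEquiv (f g : ℕ → ℝ) : Prop := Preccurly f g ∧ Preccurly g f

variable (A : Type*) [NonUnitalRing A] [Module K A] [IsScalarTower K A A] [SMulCommClass K A A]

/-- `A` is finitely generated and has exponential growth: `d_V ∼ a ^ n` for some real `a > 1`.
The condition does not depend on the generating subspace `V`; it is required for all of them. -/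
def HasExponentialGrowth : Prop :=
  (∃ V : Submodule K A, IsGenerating K V) ∧
  ∀ V : Submodule K A, IsGenerating K V →
    ∃ a : ℝ, 1 < a ∧ AsympEquiv (fun n => (growth K V n : ℝ)) (fun n => a ^ n)

/-- `A` is finitely generated and its Gelfand-Kirillov dimension `limsup log_n d_V(n)` is `d`.
The condition does not depend on the generating subspace `V`; it is required for all of them. -/
def HasGKDim (d : EReal) : Prop :=
  (∃ V : Submodule K A, IsGenerating K V) ∧
  ∀ V : Submodule K A, IsGenerating K V →
    limsup (fun n : ℕ => ((Real.logb n (growth K V n) : ℝ) : EReal)) atTop = d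

end AlgGrowth

/-! ### Non-unital algebras given by generators and relations -/

namespace NonUnitalPresentation

variable (K : Type*) [Field K] (X : Type*)

/-- The free non-unital associative `K`-algebra on `X`; the nonempty words over `X` form a
basis. -/
abbrev Free : Type _ := MonoidAlgebra K (FreeSemigroup X)

variable {X}

/-- The generator of the free algebra attached to a letter. -/
def gen (x : X) : Free K X := MonoidAlgebra.single (FreeSemigroup.of x) 1

variable {K} (r : Free K X → Free K X → Prop)

/-- All scalar multiples of the relations `r`. -/
def ScaledRel (a b : Free K X) : Prop :=
  ∃ (c : K) (x y : Free K X), r x y ∧ a = c • x ∧ b = c • y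

/-- The least `K`-algebra congruence containing `r`. -/
def con : RingCon (Free K X) := ringConGen (ScaledRel r)

theorem con_smul (c : K) {a b : Free K X} (h : con r a b) : con r (c • a) (c • b) := by
  change RingConGen.Rel _ _ _ at h
  change RingConGen.Rel _ _ _
  induction h generalizing c with
  | of a b h =>
    obtain ⟨d, x, y, hr, rfl, rfl⟩ := h
    exact .of _ _ ⟨c * d, x, y, hr, by rw [mul_smul], by rw [mul_smul]⟩
  | refl x => exact .refl _
  | symm _ ih => exact (ih c).symm
  | trans _ _ ih₁ ih₂ => exact (ih₁ c).trans (ih₂ c)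
  | add _ _ ih₁ ih₂ => rw [smul_add, smul_add]; exact (ih₁ c).add (ih₂ c)
  | mul _ h₂ ih₁ _ => rw [← smul_mul_assoc, ← smul_mul_assoc]; exact (ih₁ c).mul h₂

/-- The non-unital `K`-algebra with generators `X` and defining relations `a = b` for `r a b`. -/
def Alg : Type _ := (con r).Quotient

instance : NonUnitalRing (Alg r) := inferInstanceAs (NonUnitalRing (con r).Quotient)

/-- The quotient map, as an additive homomorphism. -/
def mkAdd : Free K X →+ Alg r where
  toFun a := ((a : (con r).Quotient))
  map_zero' := rfl
  map_add' _ _ := rfl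

theorem mkAdd_surjective : Function.Surjective (mkAdd r) := Quotient.mk''_surjective

instance : SMul K (Alg r) := ⟨(con r).smulAux fun c _ _ h => con_smul r c h⟩

instance : Module K (Alg r) :=
  Function.Surjective.module K (mkAdd r) (mkAdd_surjective r) fun _ _ => rfl

instance : IsScalarTower K (Alg r) (Alg r) where
  smul_assoc c := Quotient.ind₂' fun x y =>
    congr_arg (mkAdd r) (smul_mul_assoc c x y)

instance : SMulCommClass K (Alg r) (Alg r) where
  smul_comm c := Quotient.ind₂' fun x y =>
    congr_arg (mkAdd r) (mul_smul_comm c x y).symm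

/-- The quotient map, as a homomorphism of non-unital algebras. -/
def mk : Free K X →ₙₐ[K] Alg r where
  toFun := mkAdd r
  map_smul' _ _ := rfl
  map_zero' := rfl
  map_add' _ _ := rfl
  map_mul' _ _ := rfl

end NonUnitalPresentation

/-! ### Weighted graphs and weighted Leavitt path algebras -/

/-- A row-finite weighted graph with vertex set `V`, set of (structured) edges `E`, source map
`s`, range map `r` and weight map `w` with values in the positive integers. -/
structure WeightedGraph (V E : Type*) where
  s : E → V
  r : E → V
  w : E → ℕ
  w_pos : ∀ e, 0 < w e
  rowFinite : ∀ v, (s ⁻¹' {v}).Finite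

namespace WeightedGraph

open NonUnitalPresentation

variable {V E : Type*} (G : WeightedGraph V E)

/-- The finite set `s⁻¹(v)` of edges emitted by `v`. -/
def out (v : V) : Finset E := (G.rowFinite v).toFinset

/-- `w(v)`, the maximum of the weights of the edges emitted by `v` (it is `0` for a sink). -/
def vertexWeight (v : V) : ℕ := (G.out v).sup G.w

/-- Vertices and edges of the double graph of the directed graph associated to `G`. Indices are
shifted by one: for `i : Fin (w e)`, `real e i` is the edge `e_{i+1}` and `ghost e i` is
`e_{i+1}^*`. -/
inductive Letter : Type _
  | vertex (v : V) : Letter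
  | real (e : E) (i : Fin (G.w e)) : Letter
  | ghost (e : E) (i : Fin (G.w e)) : Letter

namespace Letter

variable {G}

/-- Source in the double graph; `s(v) = v` for a vertex. -/
def source : G.Letter → V
  | vertex v => v
  | real e _ => G.s e
  | ghost e _ => G.r e

/-- Range in the double graph; `r(v) = v` for a vertex. -/
def range : G.Letter → V
  | vertex v => v
  | real e _ => G.r e
  | ghost e _ => G.s e

end Letter

variable (K : Type*) [Field K]

/-- A vertex in the free algebra. -/
def vtx (v : V) : Free K G.Letter := gen K (Letter.vertex v)

/-- The element `e_{i+1}` of the free algebra, with `e_{i+1} = 0` if `i + 1 > w(e)`. -/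
def re (e : E) (i : ℕ) : Free K G.Letter :=
  if h : i < G.w e then gen K (Letter.real e ⟨i, h⟩) else 0

/-- The element `e_{i+1}^*` of the free algebra, with `e_{i+1}^* = 0` if `i + 1 > w(e)`. -/
def gh (e : E) (i : ℕ) : Free K G.Letter :=
  if h : i < G.w e then gen K (Letter.ghost e ⟨i, h⟩) else 0

open Classical in
/-- Defining relations of the weighted Leavitt path algebra. The first three are the relations
of the path algebra of the double graph (for a vertex `x`, `source_mul` and `mul_range` are
instances of `vertex_mul`). For the last two, `v` is a regular vertex. -/
inductive Rel : Free K G.Letter → Free K G.Letter → Prop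
  | vertex_mul (u v : V) :
      Rel (G.vtx K u * G.vtx K v) (if u = v then G.vtx K u else 0)
  | source_mul (x : G.Letter) : Rel (G.vtx K x.source * gen K x) (gen K x)
  | mul_range (x : G.Letter) : Rel (gen K x * G.vtx K x.range) (gen K x)
  | real_ghost (v : V) (hv : (G.out v).Nonempty) (i j : ℕ)
      (hi : i < G.vertexWeight v) (hj : j < G.vertexWeight v) :
      Rel (∑ e ∈ G.out v, G.re K e i * G.gh K e j) (if i = j then G.vtx K v else 0)
  | ghost_real (v : V) (e f : E) (he : e ∈ G.out v) (hf : f ∈ G.out v) :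
      Rel (∑ i ∈ Finset.range (G.vertexWeight v), G.gh K e i * G.re K f i)
        (if e = f then G.vtx K (G.r e) else 0)

/-- The weighted Leavitt path algebra `L_K(E, w)`. -/
abbrev LeavittPathAlgebra : Type _ := Alg (G.Rel K)

end WeightedGraph

/-! ### Leavitt algebras -/

namespace LeavittAlgebra

variable (K : Type*) [Field K] (m n : ℕ)

/-- Generators: the entries of an `m × n` matrix and of an `n × m` matrix. -/
abbrev Letter : Type := (Fin m × Fin n) ⊕ (Fin n × Fin m)

/-- The generic `m × n` matrix. -/
def X : Matrix (Fin m) (Fin n) (FreeAlgebra K (Letter m n)) :=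
  Matrix.of fun i j => FreeAlgebra.ι K (Sum.inl (i, j))

/-- The generic `n × m` matrix. -/
def Y : Matrix (Fin n) (Fin m) (FreeAlgebra K (Letter m n)) :=
  Matrix.of fun j i => FreeAlgebra.ι K (Sum.inr (j, i))

/-- The relations `X Y = 1` and `Y X = 1`, entry by entry. -/
inductive Rel : FreeAlgebra K (Letter m n) → FreeAlgebra K (Letter m n) → Prop
  | mul_left (i j : Fin m) :
      Rel ((X K m n * Y K m n) i j) ((1 : Matrix (Fin m) (Fin m) _) i j)
  | mul_right (i j : Fin n) :
      Rel ((Y K m n * X K m n) i j) ((1 : Matrix (Fin n) (Fin n) _) i j)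

end LeavittAlgebra

/-- The Leavitt algebra `L_K(m, n)`: the universal unital `K`-algebra with an `m × n` matrix `X`
and an `n × m` matrix `Y` such that `X Y = 1` and `Y X = 1`. -/
abbrev LeavittAlgebra (K : Type*) [Field K] (m n : ℕ) : Type _ :=
  RingQuot (LeavittAlgebra.Rel K m n)

end

/-! The algebra contains two elements whose nonempty words are pairwise distinct and linearly
independent. If both lie in the `m`-th power of a generating space `V`, the `2 ^ n` words of length
`n` give `2 ^ n ≤ d_V (m * n)`. Since `d_V` never grows faster than exponentially, this gives `d_V ∼
2 ^ n` and infinite GK dimension.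

In the paper's notation the two elements are `g_1^* g_2` and `g_2^* g_2`, where `g` is a suitable
one of the two given edges. Their independence is tested in a representation over `Q`, the
endomorphism ring of the vector space with basis the binary words. There they act as `s` and `p *
s`, where `s` prepends `1` and `p` prepends `0`. Since `{1, 01}` is a prefix code, distinct words in
them send the empty word to distinct basis vectors (`linearIndependent_lift_prepend_code`).

To represent the algebra, each regular vertex needs mutually inverse matrices over `Q` that vanish
wherever the index exceeds the weight of the edge. They exist for every shape because `Q ≅ Q ^ k` as
modules for all `k ≥ 1` (`exists_isometries`, `exists_mul_eq_one_of_isometries`). Two elementary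
operations then insert `s` and `p` (`exists_mul_eq_one_of_isometries_of_ne`), and
`exists_hom_of_isLocalRep` glues the vertices together. For Leavitt algebras the same matrices are
used without the gluing. -/

namespace AlgGrowth

/-! ### Powers of a generating space: bounds on the growth function. -/

section Pow

variable {K : Type*} [Field K] {A : Type*} [NonUnitalRing A] [Module K A]

theorem IsProd.one_le {V : Set A} {k : ℕ} {x : A} (h : IsProd V k x) : 1 ≤ k := by
  cases h <;> omega

theorem IsProd.mul_isProd {V : Set A} {k l : ℕ} {x y : A} (hx : IsProd V k x)
    (hy : IsProd V l y) : IsProd V (k + l) (x * y) := by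
  induction hy with
  | single hv => exact hx.mul hv
  | mul _ hv ih => rw [← mul_assoc, ← add_assoc]; exact ih.mul hv

theorem pow_mono (V : Submodule K A) {m n : ℕ} (h : m ≤ n) : pow K V m ≤ pow K V n :=
  Submodule.span_mono fun _ ⟨k, hk, hx⟩ => ⟨k, hk.trans h, hx⟩

theorem pow_zero (V : Submodule K A) : pow K V 0 = ⊥ := by
  refine Submodule.span_eq_bot.2 ?_
  rintro x ⟨k, hk, hx⟩
  have := hx.one_le
  omega

theorem le_pow_one (V : Submodule K A) : V ≤ pow K V 1 := fun _ hx =>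
  Submodule.subset_span ⟨1, le_rfl, .single hx⟩

variable [IsScalarTower K A A] [SMulCommClass K A A]

theorem mul_mem_pow {V : Submodule K A} {m n : ℕ} {x y : A} (hx : x ∈ pow K V m)
    (hy : y ∈ pow K V n) : x * y ∈ pow K V (m + n) := by
  have h : Submodule.map₂ (LinearMap.mul K A) (pow K V m) (pow K V n) ≤ pow K V (m + n) := by
    rw [pow, pow, Submodule.map₂_span_span, Submodule.span_le]
    rintro _ ⟨x, ⟨k, hk, hx⟩, y, ⟨l, hl, hy⟩, rfl⟩
    exact Submodule.subset_span ⟨k + l, add_le_add hk hl, hx.mul_isProd hy⟩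
  exact h (Submodule.apply_mem_map₂ _ hx hy)

theorem pow_succ_le (V : Submodule K A) (n : ℕ) :
    pow K V (n + 1) ≤ V ⊔ Submodule.map₂ (LinearMap.mul K A) (pow K V n) V := by
  refine Submodule.span_le.2 ?_
  rintro x ⟨k, hk, hx⟩
  cases hx with
  | single hv => exact Submodule.mem_sup_left hv
  | mul hx hv =>
    exact Submodule.mem_sup_right (Submodule.apply_mem_map₂ (LinearMap.mul K A)
      (Submodule.subset_span ⟨_, Nat.le_of_succ_le_succ hk, hx⟩) hv)

theorem finrank_map₂_le {M N P : Type*} [AddCommGroup M] [Module K M] [AddCommGroup N]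
    [Module K N] [AddCommGroup P] [Module K P] (f : M →ₗ[K] N →ₗ[K] P) (p : Submodule K M)
    (q : Submodule K N) [FiniteDimensional K p] [FiniteDimensional K q] :
    FiniteDimensional K (Submodule.map₂ f p q) ∧
      Module.finrank K (Submodule.map₂ f p q) ≤ Module.finrank K p * Module.finrank K q := by
  rw [TensorProduct.map₂_eq_range_lift_comp_mapIncl, ← Module.finrank_tensorProduct]
  exact ⟨inferInstance, LinearMap.finrank_range_le _⟩

/-- With `D = dim V`, the recursion `d(n+1) ≤ D + d(n) * D = D * (d(n) + 1)` closes up because the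
inequality is strict. -/
theorem finiteDimensional_pow_and_growth_lt (V : Submodule K A) [FiniteDimensional K V] (n : ℕ) :
    FiniteDimensional K (pow K V n) ∧ growth K V n < (Module.finrank K V + 1) ^ n := by
  induction n with
  | zero =>
    rw [growth, pow_zero]
    exact ⟨inferInstance, by simp⟩
  | succ n ih =>
    obtain ⟨_, h⟩ := ih
    obtain ⟨_, h'⟩ := finrank_map₂_le (LinearMap.mul K A) (pow K V n) V
    refine ⟨Submodule.finiteDimensional_of_le (pow_succ_le V n), ?_⟩
    have h₁ := (Submodule.finrank_mono (pow_succ_le V n)).trans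
      (Submodule.finrank_add_le_finrank_add_finrank _ _)
    change growth K V (n + 1) ≤ _ at h₁
    change _ ≤ growth K V n * _ at h'
    rw [_root_.pow_succ]
    nlinarith

theorem growth_mono (V : Submodule K A) [FiniteDimensional K V] : Monotone (growth K V) :=
  fun _ n h => by
    have := (finiteDimensional_pow_and_growth_lt V n).1
    exact Submodule.finrank_mono (pow_mono V h)

theorem IsGenerating.exists_mem_pow {V : Submodule K A} (hV : IsGenerating K V) (x : A) :
    ∃ n, x ∈ pow K V n := by
  have hx : x ∈ NonUnitalAlgebra.adjoin K (V : Set A) := hV.2 ▸ trivial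
  induction hx using NonUnitalAlgebra.adjoin_induction with
  | mem x hx => exact ⟨1, le_pow_one V hx⟩
  | add x y _ _ hx hy =>
    obtain ⟨m, hm⟩ := hx
    obtain ⟨n, hn⟩ := hy
    exact ⟨m + n, add_mem (pow_mono V (by omega) hm) (pow_mono V (by omega) hn)⟩
  | zero => exact ⟨0, zero_mem _⟩
  | mul x y _ _ hx hy =>
    obtain ⟨m, hm⟩ := hx
    obtain ⟨n, hn⟩ := hy
    exact ⟨m + n, mul_mem_pow hm hn⟩
  | smul c x _ hx =>
    obtain ⟨m, hm⟩ := hx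
    exact ⟨m, Submodule.smul_mem _ c hm⟩

theorem isGenerating_span_of_adjoin_eq_top {S : Set A} (hS : S.Finite)
    (h : NonUnitalAlgebra.adjoin K S = ⊤) : IsGenerating K (Submodule.span K S) :=
  ⟨FiniteDimensional.span_of_finite K hS,
    top_le_iff.1 (h ▸ NonUnitalAlgebra.adjoin_mono Submodule.subset_span)⟩

theorem lift_mem_pow {V : Submodule K A} {m : ℕ} {u : Bool → A} (hu : ∀ b, u b ∈ pow K V m)
    (x : FreeSemigroup Bool) : FreeSemigroup.lift u x ∈ pow K V (m * x.length) := by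
  induction x using FreeSemigroup.recOnMul with
  | ih1 b => simpa using hu b
  | ih2 b y hb hy =>
    rw [map_mul, FreeSemigroup.length_mul, mul_add]
    exact mul_mem_pow hb hy

/-- If two elements generate a free semigroup that is linearly independent, then the growth
function dominates `2 ^ n`. -/
theorem exists_two_pow_le_growth {u : Bool → A} (hu : LinearIndependent K (FreeSemigroup.lift u))
    {V : Submodule K A} (hV : IsGenerating K V) :
    ∃ m, 0 < m ∧ ∀ n, 0 < n → 2 ^ n ≤ growth K V (m * n) := by
  have := hV.1
  obtain ⟨m₁, h₁⟩ := hV.exists_mem_pow (u true)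
  obtain ⟨m₂, h₂⟩ := hV.exists_mem_pow (u false)
  have hm : ∀ b, u b ∈ pow K V (m₁ + m₂ + 1) := by
    rintro (_ | _)
    · exact pow_mono V (by omega) h₂
    · exact pow_mono V (by omega) h₁
  refine ⟨m₁ + m₂ + 1, by omega, fun n hn => ?_⟩
  obtain ⟨n, rfl⟩ := Nat.exists_eq_succ_of_ne_zero hn.ne'
  have := (finiteDimensional_pow_and_growth_lt V ((m₁ + m₂ + 1) * (n + 1))).1
  -- Words of length exactly `n + 1` already suffice, and there are `2 ^ (n + 1)` of them.
  let φ : (Fin (n + 1) → Bool) → FreeSemigroup Bool :=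
    fun g => ⟨g 0, List.ofFn fun i : Fin n => g i.succ⟩
  have hφ : Function.Injective φ := fun g g' h => by
    have h₁ : g 0 = g' 0 := congrArg FreeSemigroup.head h
    have h₂ := List.ofFn_injective (congrArg FreeSemigroup.tail h)
    funext i
    exact Fin.cases h₁ (fun j => congrFun h₂ j) i
  have hmem : ∀ g, FreeSemigroup.lift u (φ g) ∈ pow K V ((m₁ + m₂ + 1) * (n + 1)) := fun g => by
    have := lift_mem_pow hm (φ g)
    rwa [show (φ g).length = n + 1 by simp [φ, FreeSemigroup.length]] at this
  have hli : LinearIndependent K fun g =>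
      (⟨FreeSemigroup.lift u (φ g), hmem g⟩ : pow K V ((m₁ + m₂ + 1) * (n + 1))) :=
    LinearIndependent.of_comp (Submodule.subtype _) (hu.comp φ hφ)
  simpa [growth] using hli.fintype_card_le_finrank

end Pow

/-! ### From a free independent semigroup to exponential growth and infinite GK dimension. -/

section Exponential

variable {K : Type*} [Field K] {A : Type*} [NonUnitalRing A] [Module K A] [IsScalarTower K A A]
  [SMulCommClass K A A]

theorem hasExponentialGrowth_of_linearIndependent_lift (hA : ∃ V : Submodule K A, IsGenerating K V)
    {u : Bool → A} (hu : LinearIndependent K (FreeSemigroup.lift u)) :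
    HasExponentialGrowth K A := by
  refine ⟨hA, fun V hV => ⟨2, one_lt_two, ?_, ?_⟩⟩
  · have := hV.1
    refine ⟨Module.finrank K V + 1, Nat.succ_pos _, fun n _ => ?_⟩
    -- The base `dim V + 1` is at most `2 ^ (dim V + 1)`; the exponent is absorbed into the constant
    -- of `Preccurly`.
    have h := (finiteDimensional_pow_and_growth_lt V n).2.le.trans
      (Nat.pow_le_pow_left (Nat.lt_two_pow_self (n := Module.finrank K V + 1)).le n)
    rw [← pow_mul] at h
    have h' : (growth K V n : ℝ) ≤ 2 ^ ((Module.finrank K V + 1) * n) := by exact_mod_cast h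
    refine h'.trans (le_mul_of_one_le_left (by positivity) ?_)
    exact_mod_cast Nat.succ_pos _
  · obtain ⟨m, hm, h⟩ := exists_two_pow_le_growth hu hV
    refine ⟨m, hm, fun n hn => ?_⟩
    have h' : (2 : ℝ) ^ n ≤ growth K V (m * n) := by exact_mod_cast h n hn
    exact h'.trans (le_mul_of_one_le_left (by positivity) (by exact_mod_cast hm))

theorem hasGKDim_top_of_linearIndependent_lift (hA : ∃ V : Submodule K A, IsGenerating K V)
    {u : Bool → A} (hu : LinearIndependent K (FreeSemigroup.lift u)) : HasGKDim K A ⊤ := by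
  refine ⟨hA, fun V hV => Tendsto.limsup_eq (EReal.tendsto_coe_nhds_top_iff.2 ?_)⟩
  have := hV.1
  obtain ⟨m, hm, h⟩ := exists_two_pow_le_growth hu hV
  -- Minorant for `log_n d_V(n)`: from `d_V(n) ≥ 2 ^ ⌊n/m⌋`, where `⌊n/m⌋ ≥ n / (2m)` once `n ≥ m`.
  have hlim : Tendsto (fun n : ℕ => Real.log 2 / (2 * m) * ((n : ℝ) / Real.log n)) atTop atTop := by
    refine Tendsto.const_mul_atTop (by positivity) ?_
    have h₀ : Tendsto (fun n : ℕ => Real.log n / n) atTop (nhdsWithin 0 (Set.Ioi 0)) := by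
      refine tendsto_nhdsWithin_iff.2 ⟨?_, ?_⟩
      · exact (Real.isLittleO_log_id_atTop.tendsto_div_nhds_zero).comp tendsto_natCast_atTop_atTop
      · filter_upwards [eventually_gt_atTop 1] with n hn
        have : (1 : ℝ) < n := by exact_mod_cast hn
        exact div_pos (Real.log_pos this) (by linarith)
    exact h₀.inv_tendsto_nhdsGT_zero.congr fun n => by simp
  refine tendsto_atTop_mono' _ ?_ hlim
  filter_upwards [eventually_ge_atTop (m + 1)] with n hn
  have hq : 0 < n / m := Nat.div_pos (by omega) hm
  have h₁ : 2 ^ (n / m) ≤ growth K V n := (h _ hq).trans (growth_mono V (Nat.mul_div_le n m))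
  have h₂ : n ≤ 2 * m * (n / m) := by
    have := Nat.div_add_mod n m
    have := Nat.mod_lt n hm
    nlinarith
  have h₃ : (n / m : ℕ) * Real.log 2 ≤ Real.log (growth K V n) := by
    rw [← Real.log_pow]
    exact Real.log_le_log (by positivity) (by exact_mod_cast h₁)
  have h₄ : (n : ℝ) / (2 * m) ≤ (n / m : ℕ) := by
    rw [div_le_iff₀ (by positivity), mul_comm]
    exact_mod_cast h₂
  have hn1 : (1 : ℝ) < n := by
    have : 1 < n := by omega
    exact_mod_cast this
  have hlog := Real.log_pos hn1
  have hlog2 := Real.log_pos (one_lt_two (α := ℝ))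
  rw [Real.logb]
  calc Real.log 2 / (2 * m) * (n / Real.log n) = (n / (2 * m) * Real.log 2) / Real.log n := by ring
    _ ≤ _ := by
      refine div_le_div_of_nonneg_right (le_trans ?_ h₃) hlog.le
      exact mul_le_mul_of_nonneg_right h₄ hlog2.le

end Exponential

end AlgGrowth

/-! ### Operators on a vector space of countable dimension -/

namespace WordOperator

variable (K : Type*) [Field K]

/-- The operator that prepends the word `l` to the basis of words. -/
noncomputable def prepend (l : List Bool) : Module.End K (List Bool →₀ K) :=
  Finsupp.lmapDomain K K (l ++ ·)

theorem prepend_single (l m : List Bool) (c : K) :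
    prepend K l (Finsupp.single m c) = Finsupp.single (l ++ m) c := by
  simp [prepend]

theorem prepend_mul (l m : List Bool) : prepend K l * prepend K m = prepend K (l ++ m) := by
  ext x : 2
  simp [prepend_single]

/-- The prefix code `{1, 01}`. -/
def code : Bool → List Bool
  | true => [true]
  | false => [false, true]

/-- The first letter of an encoded word tells which code word it starts with, so the word is decoded
from the left. -/
theorem flatMap_code_injective : Function.Injective (List.flatMap code) := by
  intro l m h
  induction l generalizing m with
  | nil =>
    cases m with
    | nil => rfl
    | cons b m => cases b <;> simp [code] at h
  | cons a l ih =>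
    cases m with
    | nil => cases a <;> simp [code] at h
    | cons b m => cases a <;> cases b <;> simp [code] at h <;> rw [ih h]

theorem lift_prepend_code (x : FreeSemigroup Bool) :
    FreeSemigroup.lift (fun b => prepend K (code b)) x =
      prepend K ((x.head :: x.tail).flatMap code) := by
  induction x using FreeSemigroup.recOnMul with
  | ih1 b => simp
  | ih2 b y _ hy => rw [map_mul, hy, FreeSemigroup.lift_of, prepend_mul]; simp

/-- Evaluation at the basis vector of the empty word sends distinct products to distinct basis
vectors. -/
theorem linearIndependent_lift_prepend_code :
    LinearIndependent K (FreeSemigroup.lift fun b => prepend K (code b)) := by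
  refine LinearIndependent.of_comp (LinearMap.applyₗ (Finsupp.single [] 1)) ?_
  have h : Function.Injective fun x : FreeSemigroup Bool => (x.head :: x.tail).flatMap code :=
    fun x y h => by
      have := flatMap_code_injective h
      rw [List.cons.injEq] at this
      exact FreeSemigroup.ext this.1 this.2
  convert (Finsupp.linearIndependent_single_one K (List Bool)).comp _ h using 1
  funext x
  simp [lift_prepend_code, prepend_single]

/-- A bijection of the countable basis with `ι` copies of itself makes the space isomorphic to its
`ι`-fold power; `a i` and `b i` are the resulting inclusions and projections. -/
theorem exists_isometries (ι : Type*) [Fintype ι] [DecidableEq ι] [Nonempty ι] :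
    ∃ a b : ι → Module.End K (List Bool →₀ K),
      (∀ i j, b i * a j = if i = j then 1 else 0) ∧ ∑ i, a i * b i = 1 := by
  obtain ⟨σ⟩ := nonempty_equiv_of_countable (α := List Bool) (β := ι × List Bool)
  let Φ : (List Bool →₀ K) ≃ₗ[K] (ι → List Bool →₀ K) :=
    (Finsupp.domLCongr σ).trans
      ((Finsupp.curryLinearEquiv K).trans (Finsupp.linearEquivFunOnFinite K _ ι))
  refine ⟨fun i => Φ.symm.toLinearMap ∘ₗ LinearMap.single K (fun _ : ι => List Bool →₀ K) i,
    fun i => LinearMap.proj i ∘ₗ Φ.toLinearMap, fun i j => ?_, ?_⟩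
  · refine LinearMap.ext fun x => ?_
    by_cases h : i = j
    · subst h; simp
    · simp [h]
  · refine LinearMap.ext fun x => ?_
    simp only [LinearMap.sum_apply, Module.End.mul_apply, LinearMap.comp_apply,
      LinearEquiv.coe_coe, LinearMap.proj_apply, Module.End.one_apply]
    rw [← map_sum, LinearEquiv.symm_apply_eq]
    exact LinearMap.sum_single_apply _ _

end WordOperator

/-! ### Mutually inverse matrices with prescribed zeros -/

namespace Matrix

variable {Q : Type*} [Ring Q] {S : Type*} [Fintype S] [DecidableEq S]

/-- The column `c` expands the coordinate `e₀` into `n + 1` coordinates; the row `a` then merges the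
first of these with all coordinates other than `e₀`. The composite is invertible, and only row `0`
and column `e₀` of `X` can be nonzero. -/
theorem exists_mul_eq_one_of_isometries {n : ℕ} (e₀ : S) {a b : S → Q} {c d : Fin (n + 1) → Q}
    (hba : ∀ e f, b e * a f = if e = f then 1 else 0) (hab : ∑ e, a e * b e = 1)
    (hcd : ∀ i j, c i * d j = if i = j then 1 else 0) (hdc : ∑ i, d i * c i = 1) :
    ∃ (X : Matrix (Fin (n + 1)) S Q) (Y : Matrix S (Fin (n + 1)) Q), X * Y = 1 ∧ Y * X = 1 ∧
      ∀ e, e ≠ e₀ → (X 0 e = a e ∧ Y e 0 = b e) ∧ ∀ i, i ≠ 0 → X i e = 0 ∧ Y e i = 0 := by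
  refine ⟨Matrix.of fun i e => Fin.cases (a e * if e = e₀ then c 0 else 1)
      (fun j => if e = e₀ then c j.succ else 0) i,
    Matrix.of fun e i => Fin.cases ((if e = e₀ then d 0 else 1) * b e)
      (fun j => if e = e₀ then d j.succ else 0) i, ?_, ?_, fun e he => ⟨by simp [he], ?_⟩⟩
  · have hκ : ∀ e, (if e = e₀ then c 0 else 1) * (if e = e₀ then d 0 else 1) = 1 := fun e => by
      split_ifs
      · rw [hcd, if_pos rfl]
      · rw [mul_one]
    ext i j
    rw [Matrix.mul_apply]
    refine Fin.cases ?_ (fun i => ?_) i <;> refine Fin.cases ?_ (fun j => ?_) j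
    · simp only [Matrix.of_apply, Fin.cases_zero, one_apply_eq]
      refine Eq.trans ?_ hab
      refine Finset.sum_congr rfl fun e _ => ?_
      rw [mul_assoc, ← mul_assoc _ _ (b e), hκ, one_mul]
    · simp [mul_assoc, hcd, (Fin.succ_ne_zero _).symm]
    · refine (Finset.sum_eq_zero fun e _ => ?_).trans (one_apply_ne (Fin.succ_ne_zero i)).symm
      by_cases he : e = e₀ <;> simp [he, ← mul_assoc, hcd, Fin.succ_ne_zero]
    · simp [hcd, Matrix.one_apply]
  · ext e f
    rw [Matrix.mul_apply, Fin.sum_univ_succ]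
    simp only [Matrix.of_apply, Fin.cases_zero, Fin.cases_succ]
    rw [mul_assoc, ← mul_assoc (b e), hba, Matrix.one_apply]
    by_cases hef : e = f
    · subst hef
      by_cases he : e = e₀
      · simpa [he, Fin.sum_univ_succ] using hdc
      · simp [he]
    · by_cases he : e = e₀
      · have : f ≠ e₀ := fun h => hef (he.trans h.symm)
        simp [hef, this]
      · simp [hef, he]
  · intro i hi
    obtain ⟨j, rfl⟩ := Fin.exists_succ_eq.2 hi
    simp [he]

theorem one_add_single_mul {m : Type*} [Fintype m] [DecidableEq m] {i j : m} (h : i ≠ j) (c : Q) :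
    (1 + single i j c) * (1 - single i j c) = 1 ∧ (1 - single i j c) * (1 + single i j c) = 1 := by
  constructor <;> simp [mul_sub, sub_mul, mul_add, add_mul, single_mul_single_of_ne _ _ _ _ h.symm]

/-- Conjugating nothing but changing basis on the index side, `X` is multiplied on the left by two
elementary matrices and `Y` on the right by their inverses. Outside column `e₀`, the zero pattern of
`X` is relaxed only at position `(1, f)`, and that of `Y` only at `(f, 1)`. -/
theorem exists_mul_eq_one_of_isometries_of_ne {n : ℕ} {e₀ f : S} (hf : f ≠ e₀) {a b : S → Q}
    {c d : Fin (n + 2) → Q}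
    (hba : ∀ e f, b e * a f = if e = f then 1 else 0) (hab : ∑ e, a e * b e = 1)
    (hcd : ∀ i j, c i * d j = if i = j then 1 else 0) (hdc : ∑ i, d i * c i = 1) (s p : Q) :
    ∃ (X : Matrix (Fin (n + 2)) S Q) (Y : Matrix S (Fin (n + 2)) Q), X * Y = 1 ∧ Y * X = 1 ∧
      (∀ e, e ≠ e₀ → ∀ i, i ≠ 0 → (e = f → i ≠ 1) → X i e = 0 ∧ Y e i = 0) ∧
      Y f 0 * X 1 f = s ∧ Y f 1 * X 1 f = p * s := by
  obtain ⟨X, Y, hXY, hYX, h⟩ := exists_mul_eq_one_of_isometries e₀ hba hab hcd hdc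
  have h01 : (0 : Fin (n + 2)) ≠ 1 := Fin.zero_ne_one
  -- The factors `b f` and `a f` make `ν * a e` and `b e * μ` vanish for `e ≠ f`. For `e = f` they
  -- yield `X 1 f = a f * s`, `Y f 0 = b f` and `Y f 1 = p * b f`; the sign of `μ` cancels the one
  -- in `1 - M`.
  set ν := a f * s * b f with hν
  set μ := -(a f * p * b f) with hμ
  set N : Matrix (Fin (n + 2)) (Fin (n + 2)) Q := single 1 0 ν with hN
  set M : Matrix (Fin (n + 2)) (Fin (n + 2)) Q := single 0 1 μ with hM
  obtain ⟨hN₁, hN₂⟩ := one_add_single_mul h01.symm ν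
  obtain ⟨hM₁, hM₂⟩ := one_add_single_mul h01 μ
  rw [← hN] at hN₁ hN₂
  rw [← hM] at hM₁ hM₂
  have hX : ∀ i e, ((1 + M) * ((1 + N) * X) : Matrix (Fin (n + 2)) S Q) i e =
      X i e + (if i = 1 then ν * X 0 e else 0) +
        (if i = 0 then μ * (X 1 e + ν * X 0 e) else 0) := fun i e => by
    rw [Matrix.add_mul, Matrix.one_mul, Matrix.add_mul, Matrix.one_mul, Matrix.add_apply, Matrix.add_apply, hN, hM]
    congr 1
    · congr 1
      by_cases hi : i = 1
      · subst hi; simp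
      · simp [hi]
    · by_cases hi : i = 0
      · subst hi; simp
      · simp [hi]
  have hY : ∀ e i, ((Y * (1 - N)) * (1 - M) : Matrix S (Fin (n + 2)) Q) e i =
      Y e i - (if i = 0 then Y e 1 * ν else 0) -
        (if i = 1 then (Y e 0 - Y e 1 * ν) * μ else 0) := fun e i => by
    rw [Matrix.mul_sub, Matrix.mul_one, Matrix.mul_sub, Matrix.mul_one, Matrix.sub_apply, Matrix.sub_apply, hN, hM]
    congr 1
    · congr 1
      by_cases hi : i = 0
      · subst hi; simp
      · simp [hi]
    · by_cases hi : i = 1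
      · subst hi; simp
      · simp [hi]
  obtain ⟨⟨hf₁, hf₂⟩, hf₃⟩ := h f hf
  obtain ⟨hf₄, hf₅⟩ := hf₃ 1 h01.symm
  have hbf : b f * a f = 1 := by rw [hba, if_pos rfl]
  have hbf' : ∀ x, b f * (a f * x) = x := fun x => by rw [← mul_assoc, hbf, one_mul]
  refine ⟨(1 + M) * ((1 + N) * X), (Y * (1 - N)) * (1 - M), ?_, ?_, fun e he i hi hie => ?_, ?_, ?_⟩
  · calc _ = (1 + M) * ((1 + N) * (X * Y) * (1 - N)) * (1 - M) := by simp only [Matrix.mul_assoc]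
      _ = 1 := by rw [hXY, mul_one, hN₁, mul_one, hM₁]
  · calc _ = Y * ((1 - N) * ((1 - M) * (1 + M)) * (1 + N)) * X := by simp only [Matrix.mul_assoc]
      _ = 1 := by rw [hM₂, mul_one, hN₂, Matrix.mul_one, hYX]
  · obtain ⟨⟨h₁, h₂⟩, h₃⟩ := h e he
    obtain ⟨h₄, h₅⟩ := h₃ i hi
    obtain ⟨h₆, h₇⟩ := h₃ 1 h01.symm
    rw [hX, hY, h₁, h₂, h₄, h₅, h₇, if_neg hi, if_neg hi]
    by_cases hi1 : i = 1
    · have hef : e ≠ f := fun h => hie h hi1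
      simp [hi1, hν, hμ, mul_assoc, hba, hef.symm]
      simp [← mul_assoc, hba, hef]
    · simp [hi1]
  · rw [hX, hY, hf₁, hf₂, hf₄, hf₅]
    simp [hν, mul_assoc, hbf, hbf']
  · rw [hX, hY, hf₁, hf₂, hf₄, hf₅]
    simp [hν, hμ, mul_assoc, hbf, hbf']

end Matrix

/-! ### Universal property and finite generation of presented algebras. -/

namespace NonUnitalPresentation

variable {K : Type*} [Field K] {X : Type*} (r : Free K X → Free K X → Prop)

theorem exists_lift {B : Type*} [NonUnitalRing B] [Module K B] (F : Free K X →ₙₐ[K] B)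
    (hF : ∀ a b, r a b → F a = F b) : ∃ ψ : Alg r →ₙₐ[K] B, ∀ a, ψ (mk r a) = F a := by
  have h : ∀ a b, con r a b → F a = F b := by
    intro a b h
    change RingConGen.Rel _ _ _ at h
    induction h with
    | of a b h =>
      obtain ⟨c, x, y, hr, rfl, rfl⟩ := h
      rw [map_smul, map_smul, hF _ _ hr]
    | refl x => rfl
    | symm _ ih => exact ih.symm
    | trans _ _ ih₁ ih₂ => exact ih₁.trans ih₂
    | add _ _ ih₁ ih₂ => rw [map_add, map_add, ih₁, ih₂]
    | mul _ _ ih₁ ih₂ => rw [map_mul, map_mul, ih₁, ih₂]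
  let f : Alg r → B := Quotient.lift F h
  have hf : ∀ a, f (mk r a) = F a := fun _ => rfl
  have hs : Function.Surjective (mk r) := mkAdd_surjective r
  refine ⟨{ toFun := f, map_smul' := fun c x => ?_, map_zero' := ?_, map_add' := fun x y => ?_,
            map_mul' := fun x y => ?_ }, hf⟩
  · obtain ⟨a, rfl⟩ := hs x
    rw [← map_smul, hf, hf, map_smul]
    rfl
  · rw [← map_zero (mk r), hf, map_zero]
  · obtain ⟨a, rfl⟩ := hs x
    obtain ⟨b, rfl⟩ := hs y
    rw [← map_add, hf, hf, hf, map_add]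
  · obtain ⟨a, rfl⟩ := hs x
    obtain ⟨b, rfl⟩ := hs y
    rw [← map_mul, hf, hf, hf, map_mul]

theorem exists_free_hom {B : Type*} [NonUnitalRing B] [Module K B] [IsScalarTower K B B]
    [SMulCommClass K B B] (φ : X → B) : ∃ F : Free K X →ₙₐ[K] B, ∀ x, F (gen K x) = φ x :=
  ⟨MonoidAlgebra.liftMagma K (FreeSemigroup.lift φ), fun x => by simp [gen]⟩

theorem adjoin_range_mk_gen :
    NonUnitalAlgebra.adjoin K (Set.range fun x => mk r (gen K x)) = ⊤ := by
  refine top_le_iff.1 fun y _ => ?_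
  obtain ⟨a, rfl⟩ : ∃ a, mk r a = y := mkAdd_surjective r y
  induction a using MonoidAlgebra.induction_linear with
  | zero => rw [map_zero]; exact zero_mem _
  | add a b ha hb => rw [map_add]; exact add_mem (ha trivial) (hb trivial)
  | single x c =>
    rw [← mul_one c, ← smul_eq_mul, ← MonoidAlgebra.smul_single, map_smul]
    refine SMulMemClass.smul_mem c ?_
    induction x using FreeSemigroup.recOnMul with
    | ih1 x => exact NonUnitalAlgebra.subset_adjoin K ⟨x, rfl⟩
    | ih2 x y hx hy =>
      rw [← mul_one (1 : K), ← MonoidAlgebra.single_mul_single, map_mul]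
      exact mul_mem (hx trivial) (hy trivial)

theorem exists_isGenerating [Finite X] : ∃ V, AlgGrowth.IsGenerating K (A := Alg r) V :=
  ⟨_, AlgGrowth.isGenerating_span_of_adjoin_eq_top (Set.finite_range _) (adjoin_range_mk_gen r)⟩

end NonUnitalPresentation

/-! ### Representing the relations at a single vertex. -/

namespace WeightedGraph

/-- The relations of a weighted Leavitt path algebra at a single vertex emitting the edges in `S`,
in a unital ring in which all vertices are the identity. -/
structure IsLocalRep {Q : Type*} [Ring Q] {E : Type*} [DecidableEq E] (w : E → ℕ) (S : Finset E)
    (x y : E → ℕ → Q) : Prop where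
  re_zero : ∀ e ∈ S, ∀ i, w e ≤ i → x e i = 0
  gh_zero : ∀ e ∈ S, ∀ i, w e ≤ i → y e i = 0
  real_ghost : ∀ i < S.sup w, ∀ j < S.sup w, ∑ e ∈ S, x e i * y e j = if i = j then 1 else 0
  ghost_real : ∀ e ∈ S, ∀ f ∈ S,
    ∑ i ∈ Finset.range (S.sup w), y e i * x f i = if e = f then 1 else 0

section Local

variable {Q : Type*} [Ring Q] {E : Type*} [DecidableEq E]

theorem exists_isLocalRep_of_matrix {w : E → ℕ} {S : Finset E} {W : ℕ} (hW : S.sup w = W)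
    {X : Matrix (Fin W) S Q} {Y : Matrix S (Fin W) Q} (hXY : X * Y = 1) (hYX : Y * X = 1)
    (h : ∀ (e : S) (i : Fin W), w e ≤ i → X i e = 0 ∧ Y e i = 0) :
    ∃ x y : E → ℕ → Q, IsLocalRep w S x y ∧
      ∀ (e : S) (i : Fin W), x e i = X i e ∧ y e i = Y e i := by
  subst hW
  let x : E → ℕ → Q := fun e i => if h : e ∈ S ∧ i < S.sup w then X ⟨i, h.2⟩ ⟨e, h.1⟩ else 0
  let y : E → ℕ → Q := fun e i => if h : e ∈ S ∧ i < S.sup w then Y ⟨e, h.1⟩ ⟨i, h.2⟩ else 0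
  have hx : ∀ (e : S) (i : Fin (S.sup w)), x e i = X i e :=
    fun e i => dif_pos ⟨e.2, i.2⟩
  have hy : ∀ (e : S) (i : Fin (S.sup w)), y e i = Y e i :=
    fun e i => dif_pos ⟨e.2, i.2⟩
  refine ⟨x, y, ⟨fun e he i hi => ?_, fun e he i hi => ?_, fun i hi j hj => ?_,
    fun e he f hf => ?_⟩, fun e i => ⟨hx e i, hy e i⟩⟩
  · by_cases hiW : i < S.sup w
    · rw [hx ⟨e, he⟩ ⟨i, hiW⟩, (h ⟨e, he⟩ ⟨i, hiW⟩ hi).1]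
    · exact dif_neg fun h => hiW h.2
  · by_cases hiW : i < S.sup w
    · rw [hy ⟨e, he⟩ ⟨i, hiW⟩, (h ⟨e, he⟩ ⟨i, hiW⟩ hi).2]
    · exact dif_neg fun h => hiW h.2
  · have := congrFun (congrFun hXY ⟨i, hi⟩) ⟨j, hj⟩
    rw [Matrix.mul_apply, Matrix.one_apply] at this
    simp only [Fin.mk.injEq] at this
    rw [← this, ← Finset.sum_coe_sort]
    exact Finset.sum_congr rfl fun e _ => by rw [← hx, ← hy]
  · have := congrFun (congrFun hYX ⟨e, he⟩) ⟨f, hf⟩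
    rw [Matrix.mul_apply, Matrix.one_apply] at this
    simp only [Subtype.mk.injEq] at this
    rw [← this, ← Fin.sum_univ_eq_sum_range (fun i => y e i * x f i)]
    exact Finset.sum_congr rfl fun i _ => by rw [← hx, ← hy]

end Local

section Rep

variable (K : Type*) [Field K] {E : Type*} [DecidableEq E] {w : E → ℕ}
  {S : Finset E}

theorem exists_isLocalRep (hw : ∀ e, 0 < w e) (hS : S.Nonempty) :
    ∃ x y : E → ℕ → Module.End K (List Bool →₀ K), IsLocalRep w S x y := by
  obtain ⟨e₀, he₀, hW⟩ := Finset.exists_mem_eq_sup S hS w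
  obtain ⟨n, hn⟩ : ∃ n, S.sup w = n + 1 := ⟨w e₀ - 1, by have := hw e₀; omega⟩
  have : Nonempty S := ⟨⟨e₀, he₀⟩⟩
  obtain ⟨a, b, hba, hab⟩ := WordOperator.exists_isometries K S
  obtain ⟨d, c, hcd, hdc⟩ := WordOperator.exists_isometries K (Fin (n + 1))
  obtain ⟨X, Y, hXY, hYX, h⟩ :=
    Matrix.exists_mul_eq_one_of_isometries (Q := Module.End K (List Bool →₀ K))
      (⟨e₀, he₀⟩ : S) hba hab hcd hdc
  -- A forced zero lies outside column `e₀`, whose weight is maximal, and outside row `0`, since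
  -- weights are positive.
  obtain ⟨x, y, hxy, -⟩ := exists_isLocalRep_of_matrix hn hXY hYX fun e i hi => by
    refine (h e ?_).2 i ?_
    · rintro rfl
      have := i.2
      simp only at hi
      omega
    · rintro rfl
      have := hw e
      simp only [Fin.val_zero] at hi
      omega
  exact ⟨x, y, hxy⟩

theorem exists_isLocalRep_mul_eq (hw : ∀ e, 0 < w e) {e f : E} (he : e ∈ S) (hf : f ∈ S) (hef : e ≠ f) (hwe : 2 ≤ w e)
    (hwf : 2 ≤ w f) (s p : Module.End K (List Bool →₀ K)) :
    ∃ g ∈ S, ∃ x y : E → ℕ → Module.End K (List Bool →₀ K), IsLocalRep w S x y ∧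
      y g 0 * x g 1 = s ∧ y g 1 * x g 1 = p * s := by
  obtain ⟨e₀, he₀, hW⟩ := Finset.exists_mem_eq_sup S ⟨e, he⟩ w
  -- Two edges of weight at least `2` are needed here: one of them differs from the edge `e₀` of
  -- maximal weight, and its second entry is not forced to be zero.
  obtain ⟨g, hg, hwg, hge₀⟩ : ∃ g ∈ S, 2 ≤ w g ∧ g ≠ e₀ := by
    by_cases h : e = e₀
    · exact ⟨f, hf, hwf, fun h' => hef (h.trans h'.symm)⟩
    · exact ⟨e, he, hwe, h⟩
  obtain ⟨n, hn⟩ : ∃ n, S.sup w = n + 2 :=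
    ⟨S.sup w - 2, by have := Finset.le_sup (f := w) hg; omega⟩
  have : Nonempty S := ⟨⟨e₀, he₀⟩⟩
  obtain ⟨a, b, hba, hab⟩ := WordOperator.exists_isometries K S
  obtain ⟨d, c, hcd, hdc⟩ := WordOperator.exists_isometries K (Fin (n + 2))
  obtain ⟨X, Y, hXY, hYX, h, h₁, h₂⟩ := Matrix.exists_mul_eq_one_of_isometries_of_ne
    (Q := Module.End K (List Bool →₀ K))
    (e₀ := (⟨e₀, he₀⟩ : S)) (f := (⟨g, hg⟩ : S)) (fun h => hge₀ (congrArg Subtype.val h))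
    hba hab hcd hdc s p
  obtain ⟨x, y, hxy, hxy'⟩ := exists_isLocalRep_of_matrix hn hXY hYX fun e i hi => by
    refine h e ?_ i ?_ ?_
    · rintro rfl
      have := i.2
      simp only at hi
      omega
    · rintro rfl
      have := hw e
      simp only [Fin.val_zero] at hi
      omega
    · rintro rfl rfl
      simp only [Fin.val_one] at hi
      omega
  refine ⟨g, hg, x, y, hxy, ?_, ?_⟩
  · rw [← h₁, ← (hxy' ⟨g, hg⟩ 0).2, ← (hxy' ⟨g, hg⟩ 1).1]; rfl
  · rw [← h₂, ← (hxy' ⟨g, hg⟩ 1).2, ← (hxy' ⟨g, hg⟩ 1).1]; rfl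

end Rep

end WeightedGraph

/-! ### Gluing over the vertices, and the independent semigroup in the weighted Leavitt path
algebra. -/

namespace WeightedGraph

open NonUnitalPresentation

variable {V E : Type*} (G : WeightedGraph V E)

theorem mem_out {v : V} {e : E} : e ∈ G.out v ↔ G.s e = v := by
  simp [out]

instance [Finite V] [Finite E] : Finite G.Letter := by
  let φ : V ⊕ ((Σ e, Fin (G.w e)) ⊕ (Σ e, Fin (G.w e))) → G.Letter :=
    Sum.elim Letter.vertex (Sum.elim (fun x => Letter.real x.1 x.2) fun x => Letter.ghost x.1 x.2)
  refine Finite.of_surjective φ fun x => ?_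
  cases x with
  | vertex v => exact ⟨Sum.inl v, rfl⟩
  | real e i => exact ⟨Sum.inr (Sum.inl ⟨e, i⟩), rfl⟩
  | ghost e i => exact ⟨Sum.inr (Sum.inr ⟨e, i⟩), rfl⟩

/-- Local representations at all vertices glue to a representation of the weighted Leavitt path
algebra by matrices indexed by the vertices. -/
theorem exists_hom_of_isLocalRep {K : Type*} [Field K] {Q : Type*} [Ring Q] [Algebra K Q]
    [DecidableEq V] [Fintype V] [DecidableEq E] {x y : E → ℕ → Q}
    (h : ∀ v, (G.out v).Nonempty → IsLocalRep G.w (G.out v) x y) :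
    ∃ ψ : G.LeavittPathAlgebra K →ₙₐ[K] Matrix V V Q,
      (∀ e i, ψ (NonUnitalPresentation.mk _ (G.re K e i)) = Matrix.single (G.s e) (G.r e) (x e i)) ∧
      ∀ e i, ψ (NonUnitalPresentation.mk _ (G.gh K e i)) = Matrix.single (G.r e) (G.s e) (y e i) := by
  obtain ⟨F, hF⟩ := exists_free_hom (K := K) (X := G.Letter) (B := Matrix V V Q) fun l =>
    match l with
    | .vertex v => Matrix.single v v 1
    | .real e i => Matrix.single (G.s e) (G.r e) (x e i)
    | .ghost e i => Matrix.single (G.r e) (G.s e) (y e i)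
  have hloc : ∀ e, IsLocalRep G.w (G.out (G.s e)) x y := fun e =>
    h _ ⟨e, G.mem_out.2 rfl⟩
  have hvtx : ∀ v, F (G.vtx K v) = Matrix.single v v 1 := fun v => hF _
  have hre : ∀ e i, F (G.re K e i) = Matrix.single (G.s e) (G.r e) (x e i) := fun e i => by
    rw [re]
    split_ifs with hi
    · exact hF _
    · rw [(hloc e).re_zero e (G.mem_out.2 rfl) i (not_lt.1 hi), Matrix.single_zero, map_zero]
  have hgh : ∀ e i, F (G.gh K e i) = Matrix.single (G.r e) (G.s e) (y e i) := fun e i => by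
    rw [gh]
    split_ifs with hi
    · exact hF _
    · rw [(hloc e).gh_zero e (G.mem_out.2 rfl) i (not_lt.1 hi), Matrix.single_zero, map_zero]
  obtain ⟨ψ, hψ⟩ := exists_lift (G.Rel K) F (by
    intro a b hab
    cases hab with
    | vertex_mul u v =>
      rw [map_mul, hvtx, hvtx]
      split_ifs with huv
      · subst huv; rw [hvtx]; simp
      · rw [map_zero, Matrix.single_mul_single_of_ne _ _ _ _ huv]
    | source_mul l => rw [map_mul, hvtx, hF]; cases l <;> simp [Letter.source]
    | mul_range l => rw [map_mul, hvtx, hF]; cases l <;> simp [Letter.range]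
    | real_ghost v hv i j hi hj =>
      have : F (∑ e ∈ G.out v, G.re K e i * G.gh K e j) =
          Matrix.single v v (∑ e ∈ G.out v, x e i * y e j) := by
        rw [map_sum, ← Matrix.singleAddMonoidHom_apply, map_sum]
        refine Finset.sum_congr rfl fun e he => ?_
        rw [map_mul, hre, hgh, G.mem_out.1 he, Matrix.single_mul_single_same]
        rfl
      rw [this, (h v hv).real_ghost i hi j hj]
      split_ifs
      · exact (hvtx v).symm
      · rw [Matrix.single_zero, map_zero]
    | ghost_real v e f he hf =>
      have : F (∑ i ∈ Finset.range (G.vertexWeight v), G.gh K e i * G.re K f i) =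
          Matrix.single (G.r e) (G.r f)
            (∑ i ∈ Finset.range (G.vertexWeight v), y e i * x f i) := by
        rw [map_sum, ← Matrix.singleAddMonoidHom_apply, map_sum]
        refine Finset.sum_congr rfl fun i _ => ?_
        rw [map_mul, hre, hgh, G.mem_out.1 he, G.mem_out.1 hf, Matrix.single_mul_single_same]
        rfl
      rw [this, vertexWeight, (h v ⟨e, he⟩).ghost_real e he f hf]
      by_cases hef : e = f
      · subst hef; rw [if_pos rfl, if_pos rfl, hvtx]
      · rw [if_neg hef, if_neg hef, Matrix.single_zero, map_zero])
  exact ⟨ψ, fun e i => by rw [hψ, hre], fun e i => by rw [hψ, hgh]⟩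

theorem exists_linearIndependent_lift (K : Type*) [Field K] [Finite V] {v : V} {e f : E}
    (hef : e ≠ f) (he : G.s e = v) (hf : G.s f = v) (hwe : 2 ≤ G.w e) (hwf : 2 ≤ G.w f) :
    ∃ u : Bool → G.LeavittPathAlgebra K, LinearIndependent K (FreeSemigroup.lift u) := by
  classical
  have := Fintype.ofFinite V
  obtain ⟨g, hg, x₀, y₀, h₀, hs, hps⟩ := exists_isLocalRep_mul_eq K G.w_pos
    (G.mem_out.2 he) (G.mem_out.2 hf) hef hwe hwf (WordOperator.prepend K [true])
    (WordOperator.prepend K [false])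
  have hloc : ∀ u, ∃ x y : E → ℕ → Module.End K (List Bool →₀ K),
      ((G.out u).Nonempty → IsLocalRep G.w (G.out u) x y) ∧ (u = v → x = x₀ ∧ y = y₀) := by
    intro u
    by_cases huv : u = v
    · exact ⟨x₀, y₀, fun _ => huv ▸ h₀, fun _ => ⟨rfl, rfl⟩⟩
    by_cases hu : (G.out u).Nonempty
    · obtain ⟨x, y, h⟩ := exists_isLocalRep K G.w_pos hu
      exact ⟨x, y, fun _ => h, fun h => absurd h huv⟩
    · exact ⟨0, 0, fun h => absurd h hu, fun h => absurd h huv⟩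
  choose x y hxy hv using hloc
  have hs_eq : ∀ {u e}, e ∈ G.out u → G.s e = u := G.mem_out.1
  -- Relations (c) and (d) at a vertex involve only the edges it emits, so each edge takes its
  -- operators from its own source.
  obtain ⟨ψ, hre, hgh⟩ := G.exists_hom_of_isLocalRep (K := K)
    (x := fun e => x (G.s e) e) (y := fun e => y (G.s e) e) fun u hu =>
      { re_zero := fun e he => by rw [hs_eq he]; exact (hxy u hu).re_zero e he
        gh_zero := fun e he => by rw [hs_eq he]; exact (hxy u hu).gh_zero e he
        real_ghost := fun i hi j hj => by
          rw [← (hxy u hu).real_ghost i hi j hj]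
          exact Finset.sum_congr rfl fun e he => by rw [hs_eq he]
        ghost_real := fun e he f hf => by
          rw [← (hxy u hu).ghost_real e he f hf, hs_eq he, hs_eq hf] }
  let u : Bool → G.LeavittPathAlgebra K := fun b =>
    NonUnitalPresentation.mk _ (G.gh K g (if b then 0 else 1)) *
      NonUnitalPresentation.mk _ (G.re K g 1)
  have hu : ∀ b, ψ (u b) =
      Matrix.single (G.r g) (G.r g) (WordOperator.prepend K (WordOperator.code b)) := by
    obtain ⟨hx, hy⟩ := hv _ (hs_eq hg)
    intro b
    rw [map_mul, hre, hgh, Matrix.single_mul_single_same, hx, hy]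
    cases b
    · simp [hps, WordOperator.prepend_mul, WordOperator.code]
    · simp [hs, WordOperator.code]
  have hlift : ∀ z, ψ (FreeSemigroup.lift u z) = Matrix.single (G.r g) (G.r g)
      (FreeSemigroup.lift (fun b => WordOperator.prepend K (WordOperator.code b)) z) := fun z => by
    induction z using FreeSemigroup.recOnMul with
    | ih1 b => exact hu b
    | ih2 b z hb hz => rw [map_mul, map_mul, map_mul, hb, hz, Matrix.single_mul_single_same]
  -- Both elements map into the corner at `r g`, so reading off that one matrix entry recovers the
  -- operators.
  refine ⟨u, LinearIndependent.of_comp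
    (Matrix.entryLinearMap K _ (G.r g) (G.r g) ∘ₗ (ψ : G.LeavittPathAlgebra K →ₗ[K]
      Matrix V V (Module.End K (List Bool →₀ K)))) ?_⟩
  have h : (Matrix.entryLinearMap K _ (G.r g) (G.r g) ∘ₗ (ψ : G.LeavittPathAlgebra K →ₗ[K]
      Matrix V V (Module.End K (List Bool →₀ K)))) ∘ FreeSemigroup.lift u =
      FreeSemigroup.lift fun b => WordOperator.prepend K (WordOperator.code b) :=
    funext fun z => by simp [hlift]
  rw [h]
  exact WordOperator.linearIndependent_lift_prepend_code K

end WeightedGraph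

/-! ### Leavitt algebras. -/

namespace LeavittAlgebra

variable (K : Type*) [Field K]

theorem exists_isGenerating (m n : ℕ) :
    ∃ V, AlgGrowth.IsGenerating K (A := LeavittAlgebra K m n) V := by
  let ι : Letter m n → LeavittAlgebra K m n := fun l =>
    RingQuot.mkAlgHom K _ (FreeAlgebra.ι K l)
  -- The identity is added to the generators because generation is meant in the non-unital sense.
  refine ⟨_, AlgGrowth.isGenerating_span_of_adjoin_eq_top
    ((Set.finite_range ι).insert 1) (top_le_iff.1 fun y _ => ?_)⟩
  obtain ⟨a, rfl⟩ := RingQuot.mkAlgHom_surjective K (Rel K m n) y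
  induction a using FreeAlgebra.induction with
  | grade0 c =>
    rw [AlgHom.commutes, Algebra.algebraMap_eq_smul_one]
    exact SMulMemClass.smul_mem c (NonUnitalAlgebra.subset_adjoin K (Set.mem_insert _ _))
  | grade1 l => exact NonUnitalAlgebra.subset_adjoin K (Set.mem_insert_of_mem _ ⟨l, rfl⟩)
  | mul a b ha hb => rw [map_mul]; exact mul_mem (ha trivial) (hb trivial)
  | add a b ha hb => rw [map_add]; exact add_mem (ha trivial) (hb trivial)

theorem exists_hom {Q : Type*} [Ring Q] [Algebra K Q] {m n : ℕ} {X' : Matrix (Fin m) (Fin n) Q}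
    {Y' : Matrix (Fin n) (Fin m) Q} (hXY : X' * Y' = 1) (hYX : Y' * X' = 1) :
    ∃ ψ : LeavittAlgebra K m n →ₐ[K] Q,
      (∀ i j, ψ (RingQuot.mkAlgHom K _ (X K m n i j)) = X' i j) ∧
      ∀ j i, ψ (RingQuot.mkAlgHom K _ (Y K m n j i)) = Y' j i := by
  let F : FreeAlgebra K (Letter m n) →ₐ[K] Q :=
    FreeAlgebra.lift K (Sum.elim (fun p => X' p.1 p.2) fun p => Y' p.1 p.2)
  have hX : ∀ i j, F (X K m n i j) = X' i j := fun i j => by simp [F, X]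
  have hY : ∀ j i, F (Y K m n j i) = Y' j i := fun j i => by simp [F, Y]
  have hF : ∀ ⦃a b⦄, Rel K m n a b → F a = F b := by
    intro a b hab
    cases hab with
    | mul_left i j =>
      rw [Matrix.mul_apply, map_sum, Matrix.one_apply, apply_ite F, map_one, map_zero,
        ← Matrix.one_apply, ← hXY, Matrix.mul_apply]
      simp only [map_mul, hX, hY]
    | mul_right i j =>
      rw [Matrix.mul_apply, map_sum, Matrix.one_apply, apply_ite F, map_one, map_zero,
        ← Matrix.one_apply, ← hYX, Matrix.mul_apply]
      simp only [map_mul, hX, hY]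
  exact ⟨RingQuot.liftAlgHom K ⟨F, hF⟩, fun i j => by simp [hX], fun j i => by simp [hY]⟩

/-- No zeros are prescribed here. The bound on `m` provides the rows `0` and `1`, and the bound on
`n` a column `f = 1` different from `e₀ = 0`. -/
theorem exists_linearIndependent_lift {m n : ℕ} (hm : 1 < m) (hn : 1 < n) :
    ∃ u : Bool → LeavittAlgebra K m n, LinearIndependent K (FreeSemigroup.lift u) := by
  obtain ⟨m, rfl⟩ := Nat.exists_eq_add_of_le' hm
  obtain ⟨n, rfl⟩ := Nat.exists_eq_add_of_le' hn
  obtain ⟨a, b, hba, hab⟩ := WordOperator.exists_isometries K (Fin (n + 2))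
  obtain ⟨d, c, hcd, hdc⟩ := WordOperator.exists_isometries K (Fin (m + 2))
  obtain ⟨X', Y', hXY, hYX, -, hs, hps⟩ := Matrix.exists_mul_eq_one_of_isometries_of_ne
    (Q := Module.End K (List Bool →₀ K)) (e₀ := (0 : Fin (n + 2))) (f := 1) Fin.zero_ne_one.symm
    hba hab hcd hdc (WordOperator.prepend K [true]) (WordOperator.prepend K [false])
  obtain ⟨ψ, hX, hY⟩ := exists_hom K hXY hYX
  let u : Bool → LeavittAlgebra K (m + 2) (n + 2) := fun b =>
    RingQuot.mkAlgHom K _ (Y K (m + 2) (n + 2) 1 (if b then 0 else 1)) *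
      RingQuot.mkAlgHom K _ (X K (m + 2) (n + 2) 1 1)
  have hu : ∀ b, ψ (u b) = WordOperator.prepend K (WordOperator.code b) := by
    intro b
    rw [map_mul, hX, hY]
    cases b
    · simp [hps, WordOperator.prepend_mul, WordOperator.code]
    · simp [hs, WordOperator.code]
  have hlift : ∀ z, ψ (FreeSemigroup.lift u z) =
      FreeSemigroup.lift (fun b => WordOperator.prepend K (WordOperator.code b)) z := fun z => by
    induction z using FreeSemigroup.recOnMul with
    | ih1 b => exact hu b
    | ih2 b z hb hz => rw [map_mul, map_mul, map_mul, hb, hz]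
  refine ⟨u, LinearIndependent.of_comp ψ.toLinearMap ?_⟩
  rw [show ψ.toLinearMap ∘ FreeSemigroup.lift u = _ from funext hlift]
  exact WordOperator.linearIndependent_lift_prepend_code K

end LeavittAlgebra

theorem mainTheorem5 (K : Type*) [Field K] :
    (∀ (V : Type*) (E : Type*) [Finite V] [Finite E] (G : WeightedGraph V E)
        (v : V) (e f : E), e ≠ f → G.s e = v → G.s f = v → 2 ≤ G.w e → 2 ≤ G.w f →
        AlgGrowth.HasExponentialGrowth K (G.LeavittPathAlgebra K) ∧
        AlgGrowth.HasGKDim K (G.LeavittPathAlgebra K) ⊤) ∧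
    (∀ n k : ℕ, 1 < n →
        AlgGrowth.HasExponentialGrowth K (LeavittAlgebra K n (n + k)) ∧
        AlgGrowth.HasGKDim K (LeavittAlgebra K n (n + k)) ⊤) := by
  constructor
  · intro V E _ _ G v e f hef he hf hwe hwf
    obtain ⟨u, hu⟩ := G.exists_linearIndependent_lift K hef he hf hwe hwf
    have hA := NonUnitalPresentation.exists_isGenerating (G.Rel K)
    exact ⟨AlgGrowth.hasExponentialGrowth_of_linearIndependent_lift hA hu,
      AlgGrowth.hasGKDim_top_of_linearIndependent_lift hA hu⟩
  · intro n k hn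
    obtain ⟨u, hu⟩ := LeavittAlgebra.exists_linearIndependent_lift K hn
      (hn.trans_le (Nat.le_add_right n k))
    have hA := LeavittAlgebra.exists_isGenerating K n (n + k)
    exact ⟨AlgGrowth.hasExponentialGrowth_of_linearIndependent_lift hA hu,
      AlgGrowth.hasGKDim_top_of_linearIndependent_lift hA hu⟩
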